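/- Let $n\ge 3$ and $m\ge 1$ be integers, let $\varepsilon_1,\dots,\varepsilon_n\in\{1,-1\}$, and let $g=\sum_{i}\varepsilon_i\,dx_i^2$ be the corresponding pseudo-Euclidean metric on $\mathbb{R}^n$. Let $\alpha\in\mathbb{R}^n$ satisfy $\sum_i\varepsilon_i\alpha_i^2=1$ or $\sum_i\varepsilon_i\alpha_i^2=-1$, and put $\xi=\sum_i\alpha_ix_i$. Let $k,c_1,c_2>0$ and $b\in\mathbb{R}$ be constants, and let $N$ be one of the two numbers $N_\pm=-k\pm\sqrt{m+k^2(n-1)}$. Let $(F,g_F)$ be an $m$-dimensional Ricci-flat semi-Riemannian manifold. Then $N_+>0$ and $N_-<0$, and $N\xi+b>0$ holds exactly on the open half-space $$B=\{x:\xi>-b/N_+\}\ \text{ if } N=N_+,\qquad B=\{x:\xi<-b/N_-\}\ \text{ if } N=N_-.$$ On $B$ the functions $$\varphi=\frac{c_2}{(N\xi+b)^{k/N}},\qquad f=\frac{c_1}{(N\xi+b)^{1/N}},\qquad h=-\frac{m-(n-2)k+N}{N}\,\ln(N\xi+b)$$ are smooth, $\varphi$ and $f$ are positive, and the warped product $B\times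 F$ with the metric $\tilde g=\varphi^{-2}g+f^2g_F$ is a steady gradient Ricci soliton with potential function $h$ (viewed as a function on $B\times F$ depending only on the point of $B$), that is, $$\mathrm{Ric}_{\tilde g}+\mathrm{Hess}_{\tilde g}(h)=0 .$$ -/

import Mathlib

set_option maxSynthPendingDepth 3

open scoped Manifold ContDiff

noncomputable section

/-! ### Coordinate formulas on a normed space

Here `G` is a field of bilinear forms on (an open subset of) a real vector space `E`: the
expression of a semi-Riemannian metric in a chart. -/

namespace LocalGeometry

variable {E : Type*} [NormedAddCommGroup E] [NormedSpace ℝ E]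

/-- The Christoffel symbols of the first kind,
`koszul G y u v w = 1/2 (∂_u G(v, w) + ∂_v G(u, w) - ∂_w G(u, v))` at the point `y`, where the
partial derivatives act on the coefficients of `G` only. -/
def koszul (G : E → E →L[ℝ] E →L[ℝ] ℝ) (y : E) : E →L[ℝ] E →L[ℝ] E →L[ℝ] ℝ :=
  let D : E →L[ℝ] E →L[ℝ] E →L[ℝ] ℝ := fderiv ℝ G y
  let flip : (E →L[ℝ] E →L[ℝ] ℝ) →L[ℝ] E →L[ℝ] E →L[ℝ] ℝ :=
    (ContinuousLinearMap.flipₗᵢ ℝ E E ℝ).toContinuousLinearEquiv.toContinuousLinearMap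
  (1 / 2 : ℝ) • (D + D.flip - flip.comp D.flip)

theorem koszul_apply (G : E → E →L[ℝ] E →L[ℝ] ℝ) (y u v w : E) :
    koszul G y u v w =
      1 / 2 * (fderiv ℝ G y u v w + fderiv ℝ G y v u w - fderiv ℝ G y w u v) := by
  simp [koszul]

/-- The Christoffel symbols of the second kind (the Levi-Civita connection in coordinates):
`christoffel G y u v` is the vector `z` with `G y z w = koszul G y u v w` for all `w`.
The bilinear form `G y`, seen as a map from `E` to its dual, is inverted here; it is invertible as
soon as `G y` is nondegenerate and `E` is finite-dimensional. -/
def christoffel (G : E → E →L[ℝ] E →L[ℝ] ℝ) (y : E) : E →L[ℝ] E →L[ℝ] E :=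
  (ContinuousLinearMap.compL ℝ E (E →L[ℝ] ℝ) E (G y).inverse).comp (koszul G y)

theorem christoffel_apply (G : E → E →L[ℝ] E →L[ℝ] ℝ) (y u v : E) :
    christoffel G y u v = (G y).inverse (koszul G y u v) := rfl

/-- The endomorphism `u ↦ R(u, v) w`, where
`R(u, v) w = ∂_u Γ(v, w) - ∂_v Γ(u, w) + Γ(u, Γ(v, w)) - Γ(v, Γ(u, w))` is the curvature
tensor `∇_u ∇_v w - ∇_v ∇_u w - ∇_[u,v] w` in coordinates. -/
def curvature (G : E → E →L[ℝ] E →L[ℝ] ℝ) (y v w : E) : E →ₗ[ℝ] E where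
  toFun u := fderiv ℝ (christoffel G) y u v w - fderiv ℝ (christoffel G) y v u w
    + christoffel G y u (christoffel G y v w) - christoffel G y v (christoffel G y u w)
  map_add' a b := by
    simp only [map_add, add_apply]
    abel
  map_smul' c a := by
    simp only [map_smul, smul_apply, RingHom.id_apply, smul_add, smul_sub]

/-- The Ricci tensor in coordinates: `Ric(v, w)` is the trace of `u ↦ R(u, v) w`. -/
def ricci (G : E → E →L[ℝ] E →L[ℝ] ℝ) (y v w : E) : ℝ :=
  LinearMap.trace ℝ E (curvature G y v w)

/-- The Hessian of a function in coordinates: `Hess h (u, v) = ∂_u ∂_v h - (Γ(u, v)) h`. -/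
def hessian (G : E → E →L[ℝ] E →L[ℝ] ℝ) (h : E → ℝ) (y u v : E) : ℝ :=
  fderiv ℝ (fderiv ℝ h) y u v - fderiv ℝ h y (christoffel G y u v)

end LocalGeometry

/-! ### Semi-Riemannian manifolds (without boundary) -/

section Manifold

variable {E : Type*} [NormedAddCommGroup E] [NormedSpace ℝ E]
  {H : Type*} [TopologicalSpace H] (I : ModelWithCorners ℝ E H)
  {M : Type*} [TopologicalSpace M] [ChartedSpace H M]
  {E' : Type*} [NormedAddCommGroup E'] [NormedSpace ℝ E']
  {H' : Type*} [TopologicalSpace H'] (J : ModelWithCorners ℝ E' H')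
  {N : Type*} [TopologicalSpace N] [ChartedSpace H' N]

variable (M) in
/-- Fields of bilinear forms on the tangent spaces of `M`, i.e. `(0, 2)`-tensor fields. -/
abbrev BilinField := ∀ x : M, TangentSpace I x →L[ℝ] TangentSpace I x →L[ℝ] ℝ

variable {I J}

/-- The pullback `π^* g`, `(π^* g)_x (u, v) = g_{π x} (dπ_x u, dπ_x v)`. -/
def BilinField.pullback (π : M → N) (g : BilinField J N) : BilinField I M :=
  fun x =>
    (ContinuousLinearMap.precomp ℝ (mfderiv I J π x)).comp ((g (π x)).comp (mfderiv I J π x))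

theorem BilinField.pullback_apply (π : M → N) (g : BilinField J N) (x : M)
    (u v : TangentSpace I x) :
    g.pullback π x u v = g (π x) (mfderiv I J π x u) (mfderiv I J π x v) := rfl

/-- The expression of a field of bilinear forms in the preferred chart at `x₀`: its pullback by
the inverse of the chart. -/
def BilinField.inChart (g : BilinField I M) (x₀ : M) : E → E →L[ℝ] E →L[ℝ] ℝ :=
  BilinField.pullback (I := 𝓘(ℝ, E)) (M := E) (extChartAt I x₀).symm g

/-- `g` is a semi-Riemannian metric on the boundaryless smooth manifold `M`: a field of symmetric
nondegenerate bilinear forms whose coefficients in the charts are smooth. -/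
structure IsSemiRiemannianMetric (g : BilinField I M) : Prop where
  symm : ∀ (x : M) (u v : TangentSpace I x), g x u v = g x v u
  nondegenerate : ∀ (x : M) (u : TangentSpace I x), (∀ v, g x u v = 0) → u = 0
  smooth : ∀ x₀ : M, ContDiffOn ℝ ∞ (g.inChart x₀) (extChartAt I x₀).target

/-- The Ricci tensor of `g` at `x`, computed in the preferred chart at `x`. -/
def BilinField.ricci (g : BilinField I M) (x : M) (u v : TangentSpace I x) : ℝ :=
  LocalGeometry.ricci (g.inChart x) (extChartAt I x x)
    (mfderiv I 𝓘(ℝ, E) (extChartAt I x) x u) (mfderiv I 𝓘(ℝ, E) (extChartAt I x) x v)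

/-- The Hessian of `h` with respect to `g` at `x`, computed in the preferred chart at `x`. -/
def BilinField.hessian (g : BilinField I M) (h : M → ℝ) (x : M) (u v : TangentSpace I x) : ℝ :=
  LocalGeometry.hessian (g.inChart x) (h ∘ (extChartAt I x).symm) (extChartAt I x x)
    (mfderiv I 𝓘(ℝ, E) (extChartAt I x) x u) (mfderiv I 𝓘(ℝ, E) (extChartAt I x) x v)

/-- The metric `g` has vanishing Ricci tensor. -/
def BilinField.IsRicciFlat (g : BilinField I M) : Prop :=
  ∀ (x : M) (u v : TangentSpace I x), g.ricci x u v = 0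

/-- `(M, g)` is a gradient Ricci soliton with smooth potential function `h` and constant `ρ`:
`g` is a semi-Riemannian metric and `Ric_g + Hess_g h = ρ g`. -/
structure IsGradientRicciSoliton (g : BilinField I M) (h : M → ℝ) (ρ : ℝ) : Prop where
  metric : IsSemiRiemannianMetric g
  potential_smooth : ContMDiff I 𝓘(ℝ, ℝ) ∞ h
  equation : ∀ (x : M) (u v : TangentSpace I x),
    g.ricci x u v + g.hessian h x u v = ρ * g x u v

/-- A gradient Ricci soliton is steady if its constant `ρ` is zero. -/
def IsSteadyGradientRicciSoliton (g : BilinField I M) (h : M → ℝ) : Prop :=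
  IsGradientRicciSoliton g h 0

/-- The warped product metric `g_B + f² g_F` on the product manifold `B × F`. -/
def warpedProduct (gB : BilinField I M) (f : M → ℝ) (gF : BilinField J N) :
    BilinField (I.prod J) (M × N) :=
  fun p => gB.pullback Prod.fst p + (f p.1) ^ 2 • gF.pullback Prod.snd p

end Manifold

/-! ### The explicit data on pseudo-Euclidean space -/

section PseudoEuclidean

variable {n : ℕ}

/-- The bilinear form `(u, v) ↦ ∑ ε_i u_i v_i` on `ℝⁿ`. -/
def pseudoEuclideanForm (ε : Fin n → ℝ) :
    EuclideanSpace ℝ (Fin n) →L[ℝ] EuclideanSpace ℝ (Fin n) →L[ℝ] ℝ :=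
  ∑ i, ε i • (EuclideanSpace.proj i : EuclideanSpace ℝ (Fin n) →L[ℝ] ℝ).smulRight
    (EuclideanSpace.proj i : EuclideanSpace ℝ (Fin n) →L[ℝ] ℝ)

theorem pseudoEuclideanForm_apply (ε : Fin n → ℝ) (u v : EuclideanSpace ℝ (Fin n)) :
    pseudoEuclideanForm ε u v = ∑ i, ε i * (u i * v i) := by
  simp [pseudoEuclideanForm]

/-- The pseudo-Euclidean metric `g_{ij} = ε_i δ_{ij}` on `ℝⁿ`. -/
def pseudoEuclidean (ε : Fin n → ℝ) :
    BilinField (𝓡 n) (EuclideanSpace ℝ (Fin n)) :=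
  fun _ => pseudoEuclideanForm ε

/-- The metric `φ⁻² g` on an open subset `U` of `ℝⁿ`, for a metric `g` on `ℝⁿ`. -/
def conformalOn (U : TopologicalSpace.Opens (EuclideanSpace ℝ (Fin n)))
    (φ : EuclideanSpace ℝ (Fin n) → ℝ) (g : BilinField (𝓡 n) (EuclideanSpace ℝ (Fin n))) :
    BilinField (𝓡 n) U :=
  fun x => (1 / (φ x) ^ 2) • g.pullback (Subtype.val : U → EuclideanSpace ℝ (Fin n)) x

/-- The linear function `ξ = ∑ αᵢ xᵢ`. -/
def xi (α : Fin n → ℝ) (x : EuclideanSpace ℝ (Fin n)) : ℝ := ∑ i, α i * x i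

theorem continuous_xi (α : Fin n → ℝ) : Continuous (xi α) := by
  unfold xi
  fun_prop

/-- The open set `{N ξ + b > 0}`. -/
def solitonDomain (α : Fin n → ℝ) (N b : ℝ) :
    TopologicalSpace.Opens (EuclideanSpace ℝ (Fin n)) :=
  ⟨{x | 0 < N * xi α x + b},
    isOpen_lt continuous_const (by have := continuous_xi α; fun_prop)⟩

end PseudoEuclidean

end

/-!
In product coordinates `ℝⁿ × ℝᵐ` on `B × F` the metric is `P(l) η + Q(l) γ`, where `η` is the
pseudo-Euclidean form, `l` is the linear function `ξ`, `γ` is the metric of `F` in a chart,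
`P = φ⁻²` and `Q = f²`. Put `p = P' / (2 P)` and `q = Q' / (2 Q)`, and let `a` be the `η`-gradient
of `l`. The Christoffel symbols are then polynomial in `p`, `q`, `Q / P`, `l`, `η`, `γ` and the
Christoffel symbols of `γ` (`christoffel_warpedForm`), and so are their derivatives in these
quantities together with `p'`, `q'` (`fderiv_christoffel_warpedForm`). The curvature endomorphism
`u ↦ R(u, v) w` has two diagonal blocks, each of which is a multiple of the identity plus operators
of rank one, plus the curvature of `γ` in the second block. Taking traces gives the Ricci tensor
(`ricci_warpedForm`): up to the Ricci tensor of `γ` and the term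
`(n p + m q) l(Γ(v, w))`, it is a combination of `l ⊗ l`, `η` and `γ`.

The Hessian of a function `H(l)` is `H'' l ⊗ l - H' l(Γ(v, w))` (`hessian_comp_fst`), of the same
shape. For the given data and `t = N ξ + b` one has `p = k / t`, `q = -1 / t` and
`H' = -(m - (n - 2) k + N) / t`, whence `n p + m q - H' = (2 k + N) / t`. With this the coefficients
of `η` and `γ` in `Ric + Hess` cancel identically, while that of `l ⊗ l` is a multiple of
`N² + 2 k N - m - (n - 2) k²`, which vanishes precisely for `N = N₊` and `N = N₋`
(`ricci_add_hessian_warpedForm`). What is left is the Ricci tensor of `γ`, which is zero.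

The coordinate computation is carried over to the manifold `B × F` by computing the expression of
the warped product in the product charts (`inChart_warpedProduct`, `inChart_conformalOn`).
-/

/-! ### Traces, and semi-Riemannian metrics in coordinates -/

/-- The trace of an endomorphism of a product is the sum of the traces of its diagonal blocks. -/
theorem LinearMap.trace_eq_add_trace_prod {V W : Type*} [AddCommGroup V] [Module ℝ V]
    [FiniteDimensional ℝ V] [AddCommGroup W] [Module ℝ W] [FiniteDimensional ℝ W]
    (T : V × W →ₗ[ℝ] V × W) :
    LinearMap.trace ℝ (V × W) T =
      LinearMap.trace ℝ V (LinearMap.fst ℝ V W ∘ₗ T ∘ₗ LinearMap.inl ℝ V W) +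
        LinearMap.trace ℝ W (LinearMap.snd ℝ V W ∘ₗ T ∘ₗ LinearMap.inr ℝ V W) := by
  have h : T = (T ∘ₗ LinearMap.inl ℝ V W) ∘ₗ LinearMap.fst ℝ V W +
      (T ∘ₗ LinearMap.inr ℝ V W) ∘ₗ LinearMap.snd ℝ V W := by
    ext u <;> simp [show ((0 : V), (0 : W)) = 0 from rfl]
  conv_lhs => rw [h]
  rw [map_add, LinearMap.trace_comp_comm', LinearMap.trace_comp_comm' (LinearMap.snd ℝ V W)]

namespace LocalGeometry

variable {E : Type*} [NormedAddCommGroup E] [NormedSpace ℝ E]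

/-- `G` is a semi-Riemannian metric in coordinates on the open set `U`. -/
structure IsMetricOn (G : E → E →L[ℝ] E →L[ℝ] ℝ) (U : Set E) : Prop where
  isOpen : IsOpen U
  symm : ∀ y ∈ U, ∀ u v, G y u v = G y v u
  nondegenerate : ∀ y ∈ U, ∀ u, (∀ v, G y u v = 0) → u = 0
  smooth : ContDiffOn ℝ ∞ G U

theorem isInvertible_of_nondegenerate [FiniteDimensional ℝ E] {B : E →L[ℝ] E →L[ℝ] ℝ}
    (hB : ∀ u, (∀ v, B u v = 0) → u = 0) : B.IsInvertible := by
  have hinj : Function.Injective B.toLinearMap := by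
    rw [← LinearMap.ker_eq_bot, LinearMap.ker_eq_bot']
    exact fun u hu => hB u fun v => congrArg (fun l : E →L[ℝ] ℝ => l v) hu
  have hdim : Module.finrank ℝ E = Module.finrank ℝ (E →L[ℝ] ℝ) := by
    rw [(LinearMap.toContinuousLinearMap (𝕜 := ℝ) (E := E) (F' := ℝ)).symm.finrank_eq]
    exact (Subspace.dual_finrank_eq (K := ℝ) (V := E)).symm
  exact ⟨(LinearEquiv.ofInjectiveOfFinrankEq B.toLinearMap hinj hdim).toContinuousLinearEquiv,
    by ext; rfl⟩

variable {G G' : E → E →L[ℝ] E →L[ℝ] ℝ} {U : Set E} {y : E}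

/-- The Christoffel symbols are characterised by the Koszul formula, which spares inverting the
metric. -/
theorem christoffel_eq_of_koszul_eq [FiniteDimensional ℝ E]
    (hG : ∀ u, (∀ v, G y u v = 0) → u = 0) {u v z : E}
    (h : ∀ w, G y z w = koszul G y u v w) : christoffel G y u v = z := by
  rw [christoffel_apply, ← show G y z = koszul G y u v from ContinuousLinearMap.ext h]
  exact (isInvertible_of_nondegenerate hG).inverse_apply_eq.2 rfl

theorem apply_christoffel [FiniteDimensional ℝ E]
    (hG : ∀ u, (∀ v, G y u v = 0) → u = 0) (u v w : E) :
    G y (christoffel G y u v) w = koszul G y u v w := by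
  have h := (isInvertible_of_nondegenerate hG).inverse_apply_eq.1
    (christoffel_apply G y u v).symm
  exact congrArg (fun l : E →L[ℝ] ℝ => l w) h.symm

theorem IsMetricOn.congr {U' : Set E} (hG : IsMetricOn G U) (hU' : IsOpen U')
    (hU : U' ⊆ U) (h : ∀ y ∈ U', G' y = G y) : IsMetricOn G' U' where
  isOpen := hU'
  symm y hy u v := by rw [h y hy]; exact hG.symm y (hU hy) u v
  nondegenerate y hy := by rw [h y hy]; exact hG.nondegenerate y (hU hy)
  smooth := (hG.smooth.mono hU).congr h

theorem IsMetricOn.contDiffAt (hG : IsMetricOn G U) (hy : y ∈ U) : ContDiffAt ℝ ∞ G y :=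
  hG.smooth.contDiffAt (hG.isOpen.mem_nhds hy)

theorem IsMetricOn.differentiableAt (hG : IsMetricOn G U) (hy : y ∈ U) :
    DifferentiableAt ℝ G y :=
  (hG.contDiffAt hy).differentiableAt (by simp)

theorem fderiv_apply_apply (hG : DifferentiableAt ℝ G y) (u v w : E) :
    fderiv ℝ G y u v w = fderiv ℝ (fun z => G z v w) y u := by
  have h := (hG.hasFDerivAt.clm_apply (hasFDerivAt_const v y)).clm_apply (hasFDerivAt_const w y)
  rw [h.fderiv]
  simp

theorem IsMetricOn.fderiv_symm (hG : IsMetricOn G U) (hy : y ∈ U) (u v w : E) :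
    fderiv ℝ G y u v w = fderiv ℝ G y u w v := by
  rw [fderiv_apply_apply (hG.differentiableAt hy), fderiv_apply_apply (hG.differentiableAt hy)]
  have h : (fun z => G z v w) =ᶠ[nhds y] fun z => G z w v :=
    Filter.eventuallyEq_of_mem (hG.isOpen.mem_nhds hy) fun z hz => hG.symm z hz v w
  rw [h.fderiv_eq]

theorem IsMetricOn.christoffel_symm [FiniteDimensional ℝ E] (hG : IsMetricOn G U) (hy : y ∈ U)
    (u v : E) : christoffel G y u v = christoffel G y v u := by
  refine christoffel_eq_of_koszul_eq (hG.nondegenerate y hy) fun w => ?_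
  rw [apply_christoffel (hG.nondegenerate y hy), koszul_apply, koszul_apply,
    hG.fderiv_symm hy w v u]
  ring

theorem IsMetricOn.differentiableAt_christoffel [FiniteDimensional ℝ E] (hG : IsMetricOn G U)
    (hy : y ∈ U) : DifferentiableAt ℝ (christoffel G) y := by
  have hinv : DifferentiableAt ℝ (fun z => (G z).inverse) y := by
    obtain ⟨e, he⟩ := isInvertible_of_nondegenerate (hG.nondegenerate y hy)
    have h := (contDiffAt_map_inverse (𝕜 := ℝ) (n := ∞) e)
    rw [he] at h
    exact (h.comp y (hG.contDiffAt hy)).differentiableAt (by simp)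
  have hD : DifferentiableAt ℝ (fderiv ℝ G) y :=
    ((hG.contDiffAt hy).fderiv_right (m := ∞) (by simp)).differentiableAt (by simp)
  have hflip : DifferentiableAt ℝ (fun z => (fderiv ℝ G z).flip) y :=
    ((ContinuousLinearMap.flipₗᵢ ℝ E E
      (E →L[ℝ] ℝ)).toContinuousLinearEquiv.differentiable.differentiableAt).comp y hD
  have hK : DifferentiableAt ℝ (koszul G) y := by
    unfold koszul
    exact ((hD.add hflip).sub ((differentiableAt_const _).clm_comp hflip)).const_smul (1 / 2 : ℝ)
  unfold christoffel
  exact (((ContinuousLinearMap.compL ℝ E (E →L[ℝ] ℝ) E).differentiableAt).comp y hinv).clm_comp hK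

theorem IsMetricOn.fderiv_christoffel_apply [FiniteDimensional ℝ E] (hG : IsMetricOn G U)
    (hy : y ∈ U) (u v w : E) :
    fderiv ℝ (christoffel G) y u v w = fderiv ℝ (fun z => christoffel G z v w) y u := by
  have h := ((hG.differentiableAt_christoffel hy).hasFDerivAt.clm_apply
    (hasFDerivAt_const v y)).clm_apply (hasFDerivAt_const w y)
  rw [h.fderiv]
  simp

theorem koszul_congr (h : G =ᶠ[nhds y] G') : koszul G y = koszul G' y := by
  unfold koszul
  rw [h.fderiv_eq]

theorem christoffel_congr (h : G =ᶠ[nhds y] G') : christoffel G y = christoffel G' y := by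
  unfold christoffel
  rw [koszul_congr h, h.eq_of_nhds]

theorem ricci_congr (h : G =ᶠ[nhds y] G') (v w : E) : ricci G y v w = ricci G' y v w := by
  have h' : christoffel G =ᶠ[nhds y] christoffel G' :=
    h.eventuallyEq_nhds.mono fun z hz => christoffel_congr hz
  unfold ricci
  congr 1
  ext u
  simp only [curvature, LinearMap.coe_mk, AddHom.coe_mk]
  rw [h'.fderiv_eq, h'.eq_of_nhds]

theorem hessian_congr {f f' : E → ℝ} (h : G =ᶠ[nhds y] G') (hf : f =ᶠ[nhds y] f') (u v : E) :
    hessian G f y u v = hessian G' f' y u v := by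
  unfold hessian
  rw [hf.fderiv.fderiv_eq, hf.fderiv_eq, christoffel_congr h]

end LocalGeometry

/-! ### Warped products in coordinates -/

namespace LocalGeometry

/-- The pullback of a bilinear form by a continuous linear map. -/
noncomputable def formPullback {E E' : Type*} [NormedAddCommGroup E] [NormedSpace ℝ E]
    [NormedAddCommGroup E'] [NormedSpace ℝ E'] (π : E →L[ℝ] E') (B : E' →L[ℝ] E' →L[ℝ] ℝ) :
    E →L[ℝ] E →L[ℝ] ℝ :=
  (ContinuousLinearMap.precomp ℝ π).comp (B.comp π)

variable {V : Type*} [NormedAddCommGroup V] [NormedSpace ℝ V]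
  {W : Type*} [NormedAddCommGroup W] [NormedSpace ℝ W]

/-- The coordinate expression of the warped product metric `P(l) η + Q(l) γ` on `V × W`, where `η`
is a constant bilinear form on `V`, `l` is a linear function on `V` and `γ` is a field of bilinear
forms on `W`. -/
noncomputable def warpedForm (η : V →L[ℝ] V →L[ℝ] ℝ) (l : V →L[ℝ] ℝ) (P Q : ℝ → ℝ)
    (γ : W → W →L[ℝ] W →L[ℝ] ℝ) (z : V × W) : (V × W) →L[ℝ] (V × W) →L[ℝ] ℝ :=
  P (l z.1) • formPullback (ContinuousLinearMap.fst ℝ V W) η +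
    Q (l z.1) • formPullback (ContinuousLinearMap.snd ℝ V W) (γ z.2)

variable {η : V →L[ℝ] V →L[ℝ] ℝ} {l : V →L[ℝ] ℝ} {P Q p q : ℝ → ℝ}
  {γ : W → W →L[ℝ] W →L[ℝ] ℝ} {S : Set ℝ} {U : Set W} {a : V}

theorem warpedForm_apply (z u v : V × W) :
    warpedForm η l P Q γ z u v = P (l z.1) * η u.1 v.1 + Q (l z.1) * γ z.2 u.2 v.2 := rfl

theorem isMetricOn_warpedForm (hη : ∀ u v, η u v = η v u) (hη' : ∀ u, (∀ v, η u v = 0) → u = 0)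
    (hS : IsOpen S) (hP : ContDiffOn ℝ ∞ P S) (hQ : ContDiffOn ℝ ∞ Q S)
    (hP0 : ∀ s ∈ S, P s ≠ 0) (hQ0 : ∀ s ∈ S, Q s ≠ 0) (hγ : IsMetricOn γ U) :
    IsMetricOn (warpedForm η l P Q γ) ((l ⁻¹' S) ×ˢ U) where
  isOpen := (hS.preimage l.continuous).prod hγ.isOpen
  symm z hz u v := by
    simp only [warpedForm_apply]
    rw [hη, hγ.symm z.2 hz.2]
  nondegenerate z hz u hu := by
    refine Prod.ext (hη' _ fun v => ?_) (hγ.nondegenerate z.2 hz.2 _ fun v => ?_)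
    · have h := hu (v, 0)
      simp only [warpedForm_apply, map_zero, mul_zero, add_zero] at h
      exact (mul_eq_zero.1 h).resolve_left (hP0 _ hz.1)
    · have h := hu (0, v)
      simp only [warpedForm_apply, map_zero, mul_zero, zero_add] at h
      exact (mul_eq_zero.1 h).resolve_left (hQ0 _ hz.1)
  smooth := by
    have hl : ContDiffOn ℝ ∞ (fun z : V × W => l z.1) ((l ⁻¹' S) ×ˢ U) :=
      (l.contDiff.comp contDiff_fst).contDiffOn
    have hγ' : ContDiffOn ℝ ∞ (fun z : V × W => γ z.2) ((l ⁻¹' S) ×ˢ U) :=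
      hγ.smooth.comp contDiff_snd.contDiffOn fun z hz => hz.2
    refine ContDiffOn.add (ContDiffOn.smul (hP.comp hl fun z hz => hz.1) contDiffOn_const)
      (ContDiffOn.smul (hQ.comp hl fun z hz => hz.1) ?_)
    exact contDiffOn_const.clm_comp (hγ'.clm_comp contDiffOn_const)

theorem fderiv_warpedForm {z : V × W} {P' Q' : ℝ} (hP : HasDerivAt P P' (l z.1))
    (hQ : HasDerivAt Q Q' (l z.1)) (hγ : DifferentiableAt ℝ γ z.2)
    (hG : DifferentiableAt ℝ (warpedForm η l P Q γ) z) (u v w : V × W) :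
    fderiv ℝ (warpedForm η l P Q γ) z u v w = P' * l u.1 * η v.1 w.1 +
      Q' * l u.1 * γ z.2 v.2 w.2 + Q (l z.1) * fderiv ℝ γ z.2 u.2 v.2 w.2 := by
  have hl : HasFDerivAt (fun z : V × W => l z.1) (l.comp (ContinuousLinearMap.fst ℝ V W)) z :=
    l.hasFDerivAt.comp z hasFDerivAt_fst
  have hγ' : HasFDerivAt (fun z : V × W => γ z.2)
      ((fderiv ℝ γ z.2).comp (ContinuousLinearMap.snd ℝ V W)) z :=
    hγ.hasFDerivAt.comp z hasFDerivAt_snd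
  have hγ'' := (hγ'.clm_apply (hasFDerivAt_const v.2 z)).clm_apply (hasFDerivAt_const w.2 z)
  have h := ((hP.comp_hasFDerivAt z hl).mul (hasFDerivAt_const (η v.1 w.1) z)).add
    ((hQ.comp_hasFDerivAt z hl).mul hγ'')
  rw [fderiv_apply_apply hG]
  have e : (fun z => warpedForm η l P Q γ z v w) = fun z : V × W =>
      P (l z.1) * η v.1 w.1 + Q (l z.1) * γ z.2 v.2 w.2 := rfl
  rw [e]
  refine (congrArg (fun L : (V × W) →L[ℝ] ℝ => L u) h.fderiv).trans ?_
  simp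
  ring

/-- The Hessian of a function of `l` with respect to any metric on `V × W`: only the `V`-component
of the Christoffel symbols contributes. -/
theorem hessian_comp_fst {G : V × W → (V × W) →L[ℝ] (V × W) →L[ℝ] ℝ} {H H' : ℝ → ℝ} {H'' : ℝ}
    (hS : IsOpen S) (hH : ∀ s ∈ S, HasDerivAt H (H' s) s) {z : V × W} (hz : l z.1 ∈ S)
    (hH' : HasDerivAt H' H'' (l z.1)) (v w : V × W) :
    hessian G (fun z => H (l z.1)) z v w =
      H'' * l v.1 * l w.1 - H' (l z.1) * l (christoffel G z v w).1 := by
  have hl (y : V × W) :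
      HasFDerivAt (fun z : V × W => l z.1) (l.comp (ContinuousLinearMap.fst ℝ V W)) y :=
    l.hasFDerivAt.comp y hasFDerivAt_fst
  have h1 : ∀ y : V × W, l y.1 ∈ S → HasFDerivAt (fun z : V × W => H (l z.1))
      (H' (l y.1) • l.comp (ContinuousLinearMap.fst ℝ V W)) y :=
    fun y hy => (hH _ hy).comp_hasFDerivAt y (hl y)
  have hmem : ∀ᶠ y in nhds z, l y.1 ∈ S :=
    (l.continuous.comp continuous_fst).continuousAt.eventually (hS.mem_nhds hz)
  have h2 : fderiv ℝ (fun z : V × W => H (l z.1)) =ᶠ[nhds z]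
      fun y => H' (l y.1) • l.comp (ContinuousLinearMap.fst ℝ V W) :=
    hmem.mono fun y hy => (h1 y hy).fderiv
  have h3 := (hH'.comp_hasFDerivAt z (hl z)).smul_const (l.comp (ContinuousLinearMap.fst ℝ V W))
  have h4 : fderiv ℝ (fderiv ℝ (fun z : V × W => H (l z.1))) z = _ :=
    h2.fderiv_eq.trans h3.fderiv
  rw [hessian, h4, (h1 z hz).fderiv]
  simp

variable [FiniteDimensional ℝ V] [FiniteDimensional ℝ W]

/-- The Christoffel symbols of `P(l) η + Q(l) γ`, in terms of the logarithmic derivatives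
`p = P' / (2 P)`, `q = Q' / (2 Q)` and of the gradient `a` of `l` with respect to `η`. -/
theorem christoffel_warpedForm (ha : ∀ v, η a v = l v)
    (hγ : IsMetricOn γ U) (hG : IsMetricOn (warpedForm η l P Q γ) ((l ⁻¹' S) ×ˢ U))
    (hP : ∀ s ∈ S, HasDerivAt P (2 * p s * P s) s) (hQ : ∀ s ∈ S, HasDerivAt Q (2 * q s * Q s) s)
    (hP0 : ∀ s ∈ S, P s ≠ 0) {z : V × W} (hz : z ∈ (l ⁻¹' S) ×ˢ U) (v w : V × W) :
    christoffel (warpedForm η l P Q γ) z v w =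
      (p (l z.1) • (l v.1 • w.1 + l w.1 • v.1 - η v.1 w.1 • a) -
          (Q (l z.1) / P (l z.1) * q (l z.1) * γ z.2 v.2 w.2) • a,
        (q (l z.1) * l v.1) • w.2 + (q (l z.1) * l w.1) • v.2 + christoffel γ z.2 v.2 w.2) := by
  refine christoffel_eq_of_koszul_eq (hG.nondegenerate z hz) fun x => ?_
  have hf := fderiv_warpedForm (hP _ hz.1) (hQ _ hz.1) (hγ.differentiableAt hz.2)
    (hG.differentiableAt hz)
  have hc := apply_christoffel (hγ.nondegenerate z.2 hz.2) v.2 w.2 x.2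
  rw [koszul_apply] at hc
  have h0 := hP0 _ hz.1
  have hs := hG.symm z hz
  rw [koszul_apply, hf, hf, hf, warpedForm_apply]
  simp only [map_add, map_sub, map_smul, add_apply, sub_apply, smul_apply, smul_eq_mul, hc, ha]
  field_simp
  ring

theorem fderiv_christoffel_warpedForm {p' q' : ℝ} (ha : ∀ v, η a v = l v)
    (hγ : IsMetricOn γ U)
    (hG : IsMetricOn (warpedForm η l P Q γ) ((l ⁻¹' S) ×ˢ U))
    (hP : ∀ s ∈ S, HasDerivAt P (2 * p s * P s) s) (hQ : ∀ s ∈ S, HasDerivAt Q (2 * q s * Q s) s)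
    (hP0 : ∀ s ∈ S, P s ≠ 0) {z : V × W} (hz : z ∈ (l ⁻¹' S) ×ˢ U)
    (hp : HasDerivAt p p' (l z.1)) (hq : HasDerivAt q q' (l z.1)) (u v w : V × W) :
    fderiv ℝ (christoffel (warpedForm η l P Q γ)) z u v w =
      ((p' * l u.1) • (l v.1 • w.1 + l w.1 • v.1 - η v.1 w.1 • a) -
          (Q (l z.1) / P (l z.1) * (2 * (q (l z.1) - p (l z.1)) * q (l z.1) + q') * l u.1 *
            γ z.2 v.2 w.2 +
            Q (l z.1) / P (l z.1) * q (l z.1) * fderiv ℝ γ z.2 u.2 v.2 w.2) • a,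
        (q' * l u.1 * l v.1) • w.2 + (q' * l u.1 * l w.1) • v.2 +
          fderiv ℝ (christoffel γ) z.2 u.2 v.2 w.2) := by
  have hl : HasFDerivAt (fun z : V × W => l z.1) (l.comp (ContinuousLinearMap.fst ℝ V W)) z :=
    l.hasFDerivAt.comp z hasFDerivAt_fst
  have hγ' : HasFDerivAt (fun z : V × W => γ z.2)
      ((fderiv ℝ γ z.2).comp (ContinuousLinearMap.snd ℝ V W)) z :=
    (hγ.differentiableAt hz.2).hasFDerivAt.comp z hasFDerivAt_snd
  have hγ'' := (hγ'.clm_apply (hasFDerivAt_const v.2 z)).clm_apply (hasFDerivAt_const w.2 z)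
  have hΓ : HasFDerivAt (fun z : V × W => christoffel γ z.2)
      ((fderiv ℝ (christoffel γ) z.2).comp (ContinuousLinearMap.snd ℝ V W)) z :=
    (hγ.differentiableAt_christoffel hz.2).hasFDerivAt.comp z hasFDerivAt_snd
  have hΓ' := (hΓ.clm_apply (hasFDerivAt_const v.2 z)).clm_apply (hasFDerivAt_const w.2 z)
  have h0 := hP0 _ hz.1
  have hρ' : HasDerivAt (fun s => Q s / P s * q s)
      (Q (l z.1) / P (l z.1) * (2 * (q (l z.1) - p (l z.1)) * q (l z.1) + q')) (l z.1) := by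
    refine (((hQ _ hz.1).div (hP _ hz.1) h0).mul hq).congr_deriv ?_
    rw [Pi.div_apply]
    field_simp
  have hρ := hρ'.comp_hasFDerivAt z hl
  have h1 := ((hp.comp_hasFDerivAt z hl).smul_const (l v.1 • w.1 + l w.1 • v.1 - η v.1 w.1 • a)).sub
    ((hρ.mul hγ'').smul_const a)
  have h2 := ((((hq.comp_hasFDerivAt z hl).mul_const (l v.1)).smul_const w.2).add
    (((hq.comp_hasFDerivAt z hl).mul_const (l w.1)).smul_const v.2)).add hΓ'
  have h := h1.prodMk h2
  rw [hG.fderiv_christoffel_apply hz]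
  have e : (fun z => christoffel (warpedForm η l P Q γ) z v w) =ᶠ[nhds z] _ :=
    Filter.eventuallyEq_of_mem (hG.isOpen.mem_nhds hz) fun y hy =>
      christoffel_warpedForm ha hγ hG hP hQ hP0 hy v w
  rw [e.fderiv_eq]
  refine (congrArg (fun L : (V × W) →L[ℝ] V × W => L u) h.fderiv).trans ?_
  refine Prod.ext ?_ ?_
  · simp
    module
  · simp
    module


/-- The Ricci tensor of `P(l) η + Q(l) γ`. The last summand keeps the Christoffel symbol unexpanded,
because the Hessian of a function of `l` contains a term of the same form. -/
theorem ricci_warpedForm {p' q' : ℝ} (ha : ∀ v, η a v = l v) (hη : ∀ u v, η u v = η v u)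
    (hγ : IsMetricOn γ U)
    (hG : IsMetricOn (warpedForm η l P Q γ) ((l ⁻¹' S) ×ˢ U))
    (hP : ∀ s ∈ S, HasDerivAt P (2 * p s * P s) s) (hQ : ∀ s ∈ S, HasDerivAt Q (2 * q s * Q s) s)
    (hP0 : ∀ s ∈ S, P s ≠ 0) {z : V × W} (hz : z ∈ (l ⁻¹' S) ×ˢ U)
    (hp : HasDerivAt p p' (l z.1)) (hq : HasDerivAt q q' (l z.1)) (v w : V × W) :
    ricci (warpedForm η l P Q γ) z v w = ricci γ z.2 v.2 w.2 +
      ((2 - Module.finrank ℝ V) * p' - (Module.finrank ℝ V + 2) * p (l z.1) ^ 2 -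
        Module.finrank ℝ W * (q' + q (l z.1) ^ 2)) * l v.1 * l w.1 +
      (2 * p (l z.1) ^ 2 - p') * l a * η v.1 w.1 +
      Q (l z.1) / P (l z.1) * (2 * p (l z.1) * q (l z.1) - q') * l a * γ z.2 v.2 w.2 +
      (Module.finrank ℝ V * p (l z.1) + Module.finrank ℝ W * q (l z.1)) *
        l (christoffel (warpedForm η l P Q γ) z v w).1 := by
  set s := l z.1 with hs
  set ρ := Q s / P s * q s with hρ
  set ρ' := Q s / P s * (2 * (q s - p s) * q s + q') with hρ'
  set Z := christoffel (warpedForm η l P Q γ) z v w with hZ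
  have hΓ := christoffel_warpedForm ha hγ hG hP hQ hP0 hz
  have hDΓ := fderiv_christoffel_warpedForm ha hγ hG hP hQ hP0 hz hp hq
  have hηa : ∀ v, η v a = l v := fun v => (hη v a).trans (ha v)
  -- In the `V`-block `u = (u₁, 0)`, so the derivatives of `γ` in the direction of `u` vanish, and
  -- what remains is a multiple of the identity plus operators of rank one.
  have h1 : LinearMap.fst ℝ V W ∘ₗ curvature (warpedForm η l P Q γ) z v w ∘ₗ LinearMap.inl ℝ V W =
      (l : V →ₗ[ℝ] ℝ).smulRight
        (p' • (l v.1 • w.1 + l w.1 • v.1 - η v.1 w.1 • a) - (ρ' * γ z.2 v.2 w.2) • a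
          - (p' * l v.1) • w.1 + p s • Z.1
          - (p s ^ 2) • (l v.1 • w.1 + (2 * l w.1) • v.1 - η v.1 w.1 • a)
          + (ρ * q s * γ z.2 v.2 w.2) • a) +
      (p s * l Z.1 - p' * l v.1 * l w.1 - p s ^ 2 * l v.1 * l w.1) • LinearMap.id +
      (η w.1 : V →ₗ[ℝ] ℝ).smulRight ((p' * l v.1) • a + (p s ^ 2 * l a) • v.1) -
      (η Z.1 : V →ₗ[ℝ] ℝ).smulRight (p s • a) +
      (η v.1 : V →ₗ[ℝ] ℝ).smulRight ((p s ^ 2 * l w.1) • a) := by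
    ext u
    simp only [LinearMap.comp_apply, LinearMap.inl_apply, LinearMap.fst_apply, curvature,
      LinearMap.coe_mk, AddHom.coe_mk, hDΓ, ← hZ, hΓ]
    simp [hηa, hη u]
    module
  -- In the `W`-block the terms mixing `q` with the Christoffel symbols of `γ` cancel in pairs, by
  -- the symmetry of the latter.
  have h2 : LinearMap.snd ℝ V W ∘ₗ curvature (warpedForm η l P Q γ) z v w ∘ₗ LinearMap.inr ℝ V W =
      curvature γ z.2 v.2 w.2 +
      (q s * l Z.1 - q' * l v.1 * l w.1 - q s ^ 2 * l v.1 * l w.1) • LinearMap.id +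
      (γ z.2 w.2 : W →ₗ[ℝ] ℝ).smulRight ((q s * ρ * l a) • v.2) := by
    ext u
    have hZ2 : Z.2 = _ := congrArg Prod.snd (hΓ v w)
    simp only [LinearMap.comp_apply, LinearMap.inr_apply, LinearMap.snd_apply, curvature,
      LinearMap.coe_mk, AddHom.coe_mk, LinearMap.add_apply, hDΓ, ← hZ, hΓ, hZ2]
    simp [hγ.symm z.2 hz.2 u, hγ.christoffel_symm hz.2 u v.2]
    module
  rw [ricci, LinearMap.trace_eq_add_trace_prod, h1, h2]
  have hγw := hγ.symm z.2 hz.2 w.2 v.2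
  simp only [map_add, map_sub, map_smul, LinearMap.trace_smulRight, LinearMap.trace_id,
    ContinuousLinearMap.coe_coe, smul_eq_mul, hηa, hη w.1 v.1, hγw, ricci]
  ring

/-- The soliton equation in coordinates, for `P = (N s + b) ^ (2 k / N)`, `Q = (N s + b) ^ (-2 / N)`
up to constant factors, so that `p = k / (N s + b)` and `q = -1 / (N s + b)`. The coefficients of
`η` and `γ` vanish identically, and the coefficient of `l ⊗ l` is a multiple of
`N² + 2 k N - (m + (n - 2) k²)`. -/
theorem ricci_add_hessian_warpedForm {N k b : ℝ} {H : ℝ → ℝ} (ha : ∀ v, η a v = l v)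
    (hη : ∀ u v, η u v = η v u)
    (hN : N ^ 2 + 2 * k * N = Module.finrank ℝ W + (Module.finrank ℝ V - 2) * k ^ 2)
    (hγ : IsMetricOn γ U)
    (hG : IsMetricOn (warpedForm η l P Q γ) ((l ⁻¹' {s | 0 < N * s + b}) ×ˢ U))
    (hP : ∀ s, 0 < N * s + b → HasDerivAt P (2 * (k / (N * s + b)) * P s) s)
    (hQ : ∀ s, 0 < N * s + b → HasDerivAt Q (2 * (-1 / (N * s + b)) * Q s) s)
    (hP0 : ∀ s, 0 < N * s + b → P s ≠ 0)
    (hH : ∀ s, 0 < N * s + b → HasDerivAt H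
      (-(Module.finrank ℝ W - (Module.finrank ℝ V - 2) * k + N) / (N * s + b)) s)
    {z : V × W} (hz : z ∈ (l ⁻¹' {s | 0 < N * s + b}) ×ˢ U) (v w : V × W) :
    ricci (warpedForm η l P Q γ) z v w +
      hessian (warpedForm η l P Q γ) (fun z => H (l z.1)) z v w = ricci γ z.2 v.2 w.2 := by
  have hS : IsOpen {s : ℝ | 0 < N * s + b} := isOpen_lt (by fun_prop) (by fun_prop)
  have ht : N * l z.1 + b ≠ 0 := ne_of_gt hz.1
  have hd (c : ℝ) : HasDerivAt (fun s => c / (N * s + b)) (-(c * N) / (N * l z.1 + b) ^ 2)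
      (l z.1) := by
    have h0 : HasDerivAt (fun s => N * s + b) N (l z.1) := by
      simpa using ((hasDerivAt_id (l z.1)).const_mul N).add_const b
    exact ((hasDerivAt_const (l z.1) c).div h0 ht).congr_deriv (by ring)
  rw [ricci_warpedForm ha hη hγ hG hP hQ hP0 hz (hd k) (hd (-1)),
    hessian_comp_fst hS hH hz.1 (hd _), christoffel_warpedForm ha hγ hG hP hQ hP0 hz]
  simp only [map_add, map_sub, map_smul, smul_eq_mul]
  field_simp
  linear_combination (l v.1 * l w.1) * hN

end LocalGeometry

/-! ### Coordinate expressions of metrics on manifolds -/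

section Charts

open LocalGeometry

variable {E : Type*} [NormedAddCommGroup E] [NormedSpace ℝ E]
  {H : Type*} [TopologicalSpace H] {I : ModelWithCorners ℝ E H}
  {M : Type*} [TopologicalSpace M] [ChartedSpace H M]
  {E' : Type*} [NormedAddCommGroup E'] [NormedSpace ℝ E']
  {H' : Type*} [TopologicalSpace H'] {J : ModelWithCorners ℝ E' H'}
  {N : Type*} [TopologicalSpace N] [ChartedSpace H' N]

theorem isInvertible_mfderiv_extChartAt_symm [I.Boundaryless] [IsManifold I 1 M] {x : M} {z : E}
    (hz : z ∈ (extChartAt I x).target) :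
    (mfderiv 𝓘(ℝ, E) I (extChartAt I x).symm z).IsInvertible := by
  have h := isInvertible_mfderivWithin_extChartAt_symm hz
  rwa [I.range_eq_univ, mfderivWithin_univ] at h

theorem mdifferentiableAt_extChartAt_symm [I.Boundaryless] [IsManifold I 1 M] {x : M} {z : E}
    (hz : z ∈ (extChartAt I x).target) :
    MDifferentiableAt 𝓘(ℝ, E) I (extChartAt I x).symm z :=
  mdifferentiableAt_of_isInvertible_mfderiv (isInvertible_mfderiv_extChartAt_symm hz)

theorem IsSemiRiemannianMetric.isMetricOn_inChart [I.Boundaryless] [IsManifold I 1 M]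
    {g : BilinField I M} (hg : IsSemiRiemannianMetric g) (x : M) :
    IsMetricOn (g.inChart x) (extChartAt I x).target where
  isOpen := isOpen_extChartAt_target x
  symm z _ u v := hg.symm _ _ _
  nondegenerate z hz u hu := by
    have hi := isInvertible_mfderiv_extChartAt_symm hz
    refine hi.injective ((hg.nondegenerate _ _ fun v => ?_).trans (map_zero _).symm)
    obtain ⟨v, rfl⟩ := hi.surjective v
    exact hu v
  smooth := hg.smooth x

/-- Being a semi-Riemannian metric can be checked on the coordinate expressions. -/
theorem isSemiRiemannianMetric_of_inChart [I.Boundaryless] [IsManifold I 1 M]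
    {g : BilinField I M} (hg : ∀ x, IsMetricOn (g.inChart x) (extChartAt I x).target) :
    IsSemiRiemannianMetric g := by
  -- The point `y` is kept separate from `x`, so that the equation can be eliminated without
  -- transport between tangent spaces.
  have key (x y : M) (hy : (extChartAt I x).symm (extChartAt I x x) = y) :
      (∀ u v : TangentSpace I y, g y u v = g y v u) ∧
        ∀ u : TangentSpace I y, (∀ v, g y u v = 0) → u = 0 := by
    subst hy
    have hz := mem_extChartAt_target (I := I) x
    have hi := isInvertible_mfderiv_extChartAt_symm hz
    constructor
    · intro u v
      obtain ⟨u, rfl⟩ := hi.surjective u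
      obtain ⟨v, rfl⟩ := hi.surjective v
      exact (hg x).symm _ hz u v
    · intro u hu
      obtain ⟨u, rfl⟩ := hi.surjective u
      have hu0 : u = 0 := (hg x).nondegenerate _ hz u fun v => hu _
      exact (congrArg _ hu0).trans (map_zero _)
  exact ⟨fun x => (key x x (extChartAt_to_inv x)).1, fun x => (key x x (extChartAt_to_inv x)).2,
    fun x => (hg x).smooth⟩

/-- A Ricci-flat metric has vanishing Ricci tensor in the coordinates of the preferred chart at `x`,
at the point corresponding to `x`. -/
theorem BilinField.IsRicciFlat.ricci_inChart [I.Boundaryless] [IsManifold I 1 M]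
    {g : BilinField I M} (hg : g.IsRicciFlat) (x : M) (u v : E) :
    LocalGeometry.ricci (g.inChart x) (extChartAt I x x) u v = 0 := by
  have hi := isInvertible_mfderiv_extChartAt (I := I) (mem_extChartAt_source (I := I) x)
  obtain ⟨u, rfl⟩ := hi.surjective u
  obtain ⟨v, rfl⟩ := hi.surjective v
  exact hg x u v

/-- The expression of a warped product in the product chart is the warped product of the
expressions of the two factors, since the projections commute with the charts. -/
theorem inChart_warpedProduct [I.Boundaryless] [IsManifold I 1 M] [J.Boundaryless]
    [IsManifold J 1 N] (gB : BilinField I M) (f : M → ℝ) (gF : BilinField J N) (x : M × N)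
    {z : E × E'} (hz : z ∈ (extChartAt (I.prod J) x).target) (u v : E × E') :
    (warpedProduct gB f gF).inChart x z u v =
      gB.inChart x.1 z.1 u.1 v.1 +
        f ((extChartAt I x.1).symm z.1) ^ 2 * gF.inChart x.2 z.2 u.2 v.2 := by
  have hz' := hz
  rw [extChartAt_prod] at hz'
  have hd := mdifferentiableAt_extChartAt_symm hz
  have hf : (Prod.fst ∘ (extChartAt (I.prod J) x).symm : E × E' → M) =
      (extChartAt I x.1).symm ∘ Prod.fst := by rw [extChartAt_prod]; rfl
  have hs : (Prod.snd ∘ (extChartAt (I.prod J) x).symm : E × E' → N) =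
      (extChartAt J x.2).symm ∘ Prod.snd := by rw [extChartAt_prod]; rfl
  have h1 : mfderiv (I.prod J) I Prod.fst ((extChartAt (I.prod J) x).symm z) ∘L
      mfderiv 𝓘(ℝ, E × E') (I.prod J) (extChartAt (I.prod J) x).symm z =
      (mfderiv 𝓘(ℝ, E) I (extChartAt I x.1).symm z.1 ∘L ContinuousLinearMap.fst ℝ E E' :) := by
    refine (mfderiv_comp z mdifferentiableAt_fst hd).symm.trans ?_
    rw [hf]
    refine (mfderiv_comp z (mdifferentiableAt_extChartAt_symm hz'.1)
      differentiableAt_fst.mdifferentiableAt).trans ?_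
    rw [mfderiv_eq_fderiv, fderiv_fst]
    rfl
  have h2 : mfderiv (I.prod J) J Prod.snd ((extChartAt (I.prod J) x).symm z) ∘L
      mfderiv 𝓘(ℝ, E × E') (I.prod J) (extChartAt (I.prod J) x).symm z =
      (mfderiv 𝓘(ℝ, E') J (extChartAt J x.2).symm z.2 ∘L ContinuousLinearMap.snd ℝ E E' :) := by
    refine (mfderiv_comp z mdifferentiableAt_snd hd).symm.trans ?_
    rw [hs]
    refine (mfderiv_comp z (mdifferentiableAt_extChartAt_symm hz'.2)
      differentiableAt_snd.mdifferentiableAt).trans ?_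
    rw [mfderiv_eq_fderiv, fderiv_snd]
    rfl
  have h1' (u : E × E') := congrArg (fun L : (E × E') →L[ℝ] E => L u) h1
  have h2' (u : E × E') := congrArg (fun L : (E × E') →L[ℝ] E' => L u) h2
  have hx1 := congrFun hf z
  have hx2 := congrFun hs z
  have hB : ∀ (y y' : M) (a b a' b' : E), y = y' → a = a' → b = b' →
      gB y a b = gB y' a' b' := by rintro y _ a b _ _ rfl rfl rfl; rfl
  have hF : ∀ (y y' : N) (a b a' b' : E'), y = y' → a = a' → b = b' →
      gF y a b = gF y' a' b' := by rintro y _ a b _ _ rfl rfl rfl; rfl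
  exact congrArg₂ (· + ·) (hB _ _ _ _ _ _ hx1 (h1' u) (h1' v))
    (congrArg₂ (· * ·) (congrArg (fun y => f y ^ 2) hx1) (hF _ _ _ _ _ _ hx2 (h2' u) (h2' v)))

/-- Charts of an open subset of `ℝⁿ` are restrictions of the identity. -/
theorem inChart_conformalOn {n : ℕ} (U : TopologicalSpace.Opens (EuclideanSpace ℝ (Fin n)))
    (φ : EuclideanSpace ℝ (Fin n) → ℝ) (ε : Fin n → ℝ) (x : U)
    {z : EuclideanSpace ℝ (Fin n)} (hz : z ∈ (extChartAt (𝓡 n) x).target)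
    (u v : EuclideanSpace ℝ (Fin n)) :
    (conformalOn U φ (pseudoEuclidean ε)).inChart x z u v =
      1 / φ z ^ 2 * pseudoEuclideanForm ε u v := by
  have hval (y : EuclideanSpace ℝ (Fin n)) (hy : y ∈ (extChartAt (𝓡 n) x).target) :
      ((extChartAt (𝓡 n) x).symm y : EuclideanSpace ℝ (Fin n)) = y :=
    (extChartAt (𝓡 n) x).right_inv hy
  have he : (Subtype.val ∘ (extChartAt (𝓡 n) x).symm : _ → EuclideanSpace ℝ (Fin n))
      =ᶠ[nhds z] id :=
    Filter.eventuallyEq_of_mem ((isOpen_extChartAt_target x).mem_nhds hz) hval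
  have hd : mfderiv (𝓡 n) (𝓡 n) (Subtype.val : U → EuclideanSpace ℝ (Fin n))
        ((extChartAt (𝓡 n) x).symm z) ∘L
      mfderiv 𝓘(ℝ, EuclideanSpace ℝ (Fin n)) (𝓡 n) (extChartAt (𝓡 n) x).symm z =
      (ContinuousLinearMap.id ℝ (EuclideanSpace ℝ (Fin n)) :) := by
    refine (mfderiv_comp z (contMDiff_subtype_val.mdifferentiable (n := 1) (by simp) _)
      (mdifferentiableAt_extChartAt_symm hz)).symm.trans ?_
    rw [he.mfderiv_eq]
    exact mfderiv_id
  have hd' (u : EuclideanSpace ℝ (Fin n)) := congrArg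
    (fun L : EuclideanSpace ℝ (Fin n) →L[ℝ] EuclideanSpace ℝ (Fin n) => L u) hd
  have h : (conformalOn U φ (pseudoEuclidean ε)).inChart x z u v =
      1 / φ ((extChartAt (𝓡 n) x).symm z) ^ 2 * pseudoEuclideanForm ε
        (mfderiv (𝓡 n) (𝓡 n) (Subtype.val : U → EuclideanSpace ℝ (Fin n)) _
          (mfderiv 𝓘(ℝ, EuclideanSpace ℝ (Fin n)) (𝓡 n) (extChartAt (𝓡 n) x).symm z u))
        (mfderiv (𝓡 n) (𝓡 n) (Subtype.val : U → EuclideanSpace ℝ (Fin n)) _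
          (mfderiv 𝓘(ℝ, EuclideanSpace ℝ (Fin n)) (𝓡 n) (extChartAt (𝓡 n) x).symm z v)) := rfl
  rw [h, hval z hz]
  exact congrArg₂ (fun a b => 1 / φ z ^ 2 * pseudoEuclideanForm ε a b) (hd' u) (hd' v)

end Charts

/-! ### The soliton on pseudo-Euclidean space -/

section PseudoEuclidean

variable {n : ℕ}

theorem pseudoEuclideanForm_symm (ε : Fin n → ℝ) (u v : EuclideanSpace ℝ (Fin n)) :
    pseudoEuclideanForm ε u v = pseudoEuclideanForm ε v u := by
  simp only [pseudoEuclideanForm_apply, mul_comm (u _)]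

theorem pseudoEuclideanForm_nondegenerate {ε : Fin n → ℝ} (hε : ∀ i, ε i ≠ 0)
    (u : EuclideanSpace ℝ (Fin n)) (hu : ∀ v, pseudoEuclideanForm ε u v = 0) : u = 0 := by
  ext i
  have h := hu (EuclideanSpace.single i 1)
  simpa [pseudoEuclideanForm_apply, hε i] using h

/-- The function `xi α` as a linear functional. -/
noncomputable def xiL (α : Fin n → ℝ) : EuclideanSpace ℝ (Fin n) →L[ℝ] ℝ :=
  ∑ i, α i • (EuclideanSpace.proj i : EuclideanSpace ℝ (Fin n) →L[ℝ] ℝ)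

theorem xiL_apply (α : Fin n → ℝ) (x : EuclideanSpace ℝ (Fin n)) : xiL α x = xi α x := by
  simp [xiL, xi]

/-- The gradient of `xi α` with respect to the pseudo-Euclidean form. -/
theorem exists_pseudoEuclideanForm_eq_xiL {ε : Fin n → ℝ} (hε : ∀ i, ε i ≠ 0) (α : Fin n → ℝ) :
    ∃ a, ∀ v, pseudoEuclideanForm ε a v = xiL α v := by
  refine ⟨WithLp.toLp 2 fun i => α i / ε i, fun v => ?_⟩
  rw [pseudoEuclideanForm_apply, xiL_apply, xi]
  refine Finset.sum_congr rfl fun i _ => ?_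
  have := hε i
  simp only
  field_simp

end PseudoEuclidean

/-- The derivative of `c (N s + b) ^ r`, as a multiple of the function itself. -/
theorem hasDerivAt_const_mul_affine_rpow {N b : ℝ} (c r : ℝ) {s : ℝ} (hs : 0 < N * s + b) :
    HasDerivAt (fun s => c * (N * s + b) ^ r)
      (r * N / (N * s + b) * (c * (N * s + b) ^ r)) s := by
  have h0 : HasDerivAt (fun s => N * s + b) N s := by
    simpa using ((hasDerivAt_id s).const_mul N).add_const b
  refine ((h0.rpow_const (p := r) (Or.inl hs.ne')).const_mul c).congr_deriv ?_
  rw [Real.rpow_sub_one hs.ne']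
  field_simp

theorem contDiffOn_const_mul_affine_rpow (N b c r : ℝ) :
    ContDiffOn ℝ ∞ (fun s => c * (N * s + b) ^ r) {s | 0 < N * s + b} := by
  refine contDiffOn_const.mul (ContDiffOn.rpow_const_of_ne ?_ fun s hs => ne_of_gt hs)
  fun_prop

theorem contDiffOn_log_affine (N b c : ℝ) :
    ContDiffOn ℝ ∞ (fun s => c * Real.log (N * s + b)) {s | 0 < N * s + b} := by
  refine contDiffOn_const.mul (ContDiffOn.log ?_ fun s hs => ne_of_gt hs)
  fun_prop

theorem hasDerivAt_log_affine {N b : ℝ} (c : ℝ) {s : ℝ} (hs : 0 < N * s + b) :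
    HasDerivAt (fun s => c * Real.log (N * s + b)) (c * N / (N * s + b)) s := by
  have h0 : HasDerivAt (fun s => N * s + b) N s := by
    simpa using ((hasDerivAt_id s).const_mul N).add_const b
  exact ((h0.log hs.ne').const_mul c).congr_deriv (by ring)

open LocalGeometry in
/-- The warped product is a steady soliton as soon as `N ≠ 0` solves
`N² + 2 k N = m + (n - 2) k²`. -/
theorem isSteadyGradientRicciSoliton_warpedProduct {n m : ℕ} {ε : Fin n → ℝ} (hε : ∀ i, ε i ≠ 0)
    (α : Fin n → ℝ) {k c₁ c₂ b N : ℝ} (hc₁ : c₁ ≠ 0) (hc₂ : c₂ ≠ 0) (hN0 : N ≠ 0)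
    (hN : N ^ 2 + 2 * k * N = m + (n - 2) * k ^ 2)
    {F : Type*} [TopologicalSpace F] [ChartedSpace (EuclideanSpace ℝ (Fin m)) F]
    [IsManifold (𝓡 m) ∞ F] {gF : BilinField (𝓡 m) F}
    (hgF : IsSemiRiemannianMetric gF) (hflat : gF.IsRicciFlat) :
    IsSteadyGradientRicciSoliton
      (warpedProduct (conformalOn (solitonDomain α N b)
        (fun x => c₂ / (N * xi α x + b) ^ (k / N)) (pseudoEuclidean ε))
        (fun x => c₁ / (N * xi α x + b) ^ (1 / N)) gF)
      (fun p => -((m - (n - 2) * k + N) / N) * Real.log (N * xi α p.1 + b)) := by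
  have : IsManifold (𝓡 m) 1 F := IsManifold.of_le (n := ∞) (by simp)
  set B := solitonDomain α N b
  set S : Set ℝ := {s | 0 < N * s + b}
  set g := warpedProduct (conformalOn B
        (fun x => c₂ / (N * xi α x + b) ^ (k / N)) (pseudoEuclidean ε))
        (fun x : B => c₁ / (N * xi α x + b) ^ (1 / N)) gF
  obtain ⟨a, ha⟩ := exists_pseudoEuclideanForm_eq_xiL hε α
  -- `P = φ⁻²` and `Q = f²` as functions of the value of `ξ`.
  let P : ℝ → ℝ := fun s => 1 / c₂ ^ 2 * (N * s + b) ^ (2 * k / N)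
  let Q : ℝ → ℝ := fun s => c₁ ^ 2 * (N * s + b) ^ (-2 / N)
  have hP0 : ∀ s ∈ S, P s ≠ 0 := fun s hs =>
    mul_ne_zero (by positivity) (Real.rpow_pos_of_pos hs _).ne'
  have hQ0 : ∀ s ∈ S, Q s ≠ 0 := fun s hs =>
    mul_ne_zero (by positivity) (Real.rpow_pos_of_pos hs _).ne'
  have hS : IsOpen S := isOpen_lt (by fun_prop) (by fun_prop)
  let G (x : B × F) := warpedForm (pseudoEuclideanForm ε) (xiL α) P Q (gF.inChart x.2)
  have hγ (x : B × F) := hgF.isMetricOn_inChart x.2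
  have hG (x : B × F) : IsMetricOn (G x)
      ((xiL α ⁻¹' S) ×ˢ (extChartAt (𝓡 m) x.2).target) :=
    isMetricOn_warpedForm (pseudoEuclideanForm_symm ε) (pseudoEuclideanForm_nondegenerate hε) hS
      (contDiffOn_const_mul_affine_rpow N b _ _) (contDiffOn_const_mul_affine_rpow N b _ _)
      hP0 hQ0 (hγ x)
  have hval (x : B) (y : EuclideanSpace ℝ (Fin n)) (hy : y ∈ (extChartAt (𝓡 n) x).target) :
      ((extChartAt (𝓡 n) x).symm y : EuclideanSpace ℝ (Fin n)) = y :=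
    (extChartAt (𝓡 n) x).right_inv hy
  have htgt (x : B × F) {z} (hz : z ∈ (extChartAt ((𝓡 n).prod (𝓡 m)) x).target) :
      z.1 ∈ (extChartAt (𝓡 n) x.1).target ∧ z.2 ∈ (extChartAt (𝓡 m) x.2).target := by
    rw [extChartAt_prod] at hz
    exact hz
  have hsub (x : B × F) : (extChartAt ((𝓡 n).prod (𝓡 m)) x).target ⊆
      (xiL α ⁻¹' S) ×ˢ (extChartAt (𝓡 m) x.2).target := by
    intro z hz
    refine ⟨?_, (htgt x hz).2⟩
    have h : 0 < N * xi α ((extChartAt (𝓡 n) x.1).symm z.1) + b :=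
      ((extChartAt (𝓡 n) x.1).symm z.1).2
    rw [hval _ _ (htgt x hz).1, ← xiL_apply] at h
    exact h
  have hgG (x : B × F) : ∀ z ∈ (extChartAt ((𝓡 n).prod (𝓡 m)) x).target,
      g.inChart x z = G x z := by
    intro z hz
    have ht : 0 < N * xi α z.1 + b := by
      rw [← xiL_apply]; exact (hsub x hz).1
    refine ContinuousLinearMap.ext fun u => ContinuousLinearMap.ext fun v => ?_
    rw [inChart_warpedProduct _ _ _ _ hz, inChart_conformalOn _ _ _ _ (htgt x hz).1,
      warpedForm_apply, hval _ _ (htgt x hz).1, xiL_apply]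
    have h2 (r : ℝ) : ((N * xi α z.1 + b) ^ (r / N)) ^ 2 =
        (N * xi α z.1 + b) ^ (2 * r / N) := by
      rw [← Real.rpow_mul_natCast ht.le]
      congr 1
      push_cast
      ring
    congr 2
    · simp only [P]
      rw [div_pow, h2]
      field_simp
    · simp only [Q]
      rw [div_pow, h2, neg_div, Real.rpow_neg ht.le, mul_one, div_eq_mul_inv]
  have hmet (x : B × F) : IsMetricOn (g.inChart x) (extChartAt ((𝓡 n).prod (𝓡 m)) x).target :=
    (hG x).congr (isOpen_extChartAt_target x) (hsub x) (hgG x)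
  refine ⟨isSemiRiemannianMetric_of_inChart hmet, ?_, fun x u v => ?_⟩
  · have h1 : ContDiffOn ℝ ∞ (fun y : EuclideanSpace ℝ (Fin n) =>
        -((m - (n - 2) * k + N) / N) * Real.log (N * xi α y + b)) B := by
      simp only [← xiL_apply]
      refine (contDiffOn_log_affine N b _).comp (xiL α).contDiff.contDiffOn fun y hy => ?_
      rw [xiL_apply]
      exact hy
    have h2 : ContMDiff ((𝓡 n).prod (𝓡 m)) (𝓡 n) ∞
        fun p : B × F => (p.1 : EuclideanSpace ℝ (Fin n)) :=
      contMDiff_subtype_val.comp contMDiff_fst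
    exact fun x => ContMDiffAt.comp (g := fun y : EuclideanSpace ℝ (Fin n) =>
      -((m - (n - 2) * k + N) / N) * Real.log (N * xi α y + b)) x
      (h1.contDiffAt (B.isOpen.mem_nhds x.1.2)).contMDiffAt (h2 x)
  · have hx := mem_extChartAt_target (I := (𝓡 n).prod (𝓡 m)) x
    have hev := Filter.eventuallyEq_of_mem ((isOpen_extChartAt_target x).mem_nhds hx) (hgG x)
    have key (u v : EuclideanSpace ℝ (Fin n) × EuclideanSpace ℝ (Fin m)) :
        LocalGeometry.ricci (g.inChart x) (extChartAt ((𝓡 n).prod (𝓡 m)) x x) u v +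
        LocalGeometry.hessian (g.inChart x)
          ((fun p : B × F => -((m - (n - 2) * k + N) / N) * Real.log (N * xi α p.1 + b)) ∘
          (extChartAt ((𝓡 n).prod (𝓡 m)) x).symm) (extChartAt ((𝓡 n).prod (𝓡 m)) x x) u v = 0 := by
      rw [ricci_congr hev,
        hessian_congr (f' := fun z => -((m - (n - 2) * k + N) / N) *
          Real.log (N * xiL α z.1 + b)) hev]
      · refine (ricci_add_hessian_warpedForm
          (H := fun s => -((m - (n - 2) * k + N) / N) * Real.log (N * s + b)) ha
          (pseudoEuclideanForm_symm ε) (by simpa using hN) (hγ x) (hG x) (fun s hs => ?_)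
          (fun s hs => ?_) hP0 (fun s hs => ?_) (hsub x hx) u v).trans
          (hflat.ricci_inChart x.2 u.2 v.2)
        · refine (hasDerivAt_const_mul_affine_rpow _ _ hs).congr_deriv ?_
          change _ * P s = _ * P s
          congr 1
          field_simp
        · refine (hasDerivAt_const_mul_affine_rpow _ _ hs).congr_deriv ?_
          change _ * Q s = _ * Q s
          congr 1
          field_simp
        · refine (hasDerivAt_log_affine _ hs).congr_deriv ?_
          rw [neg_mul, div_mul_cancel₀ _ hN0, finrank_euclideanSpace_fin,
            finrank_euclideanSpace_fin]
      · refine Filter.eventuallyEq_of_mem ((isOpen_extChartAt_target x).mem_nhds hx) fun z hz => ?_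
        have h : (((extChartAt ((𝓡 n).prod (𝓡 m)) x).symm z).1 : EuclideanSpace ℝ (Fin n)) =
            z.1 := by
          rw [extChartAt_prod]
          exact hval _ _ (htgt x hz).1
        simp only [Function.comp_apply, h, xiL_apply]
    exact (key _ _).trans (zero_mul _).symm

theorem theorem1p4 (n m : ℕ) (hn : 3 ≤ n) (hm : 1 ≤ m)
    (ε : Fin n → ℝ) (hε : ∀ i, ε i = 1 ∨ ε i = -1)
    (α : Fin n → ℝ) (hα : ∑ i, ε i * α i ^ 2 = 1 ∨ ∑ i, ε i * α i ^ 2 = -1)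
    (k c₁ c₂ b N : ℝ) (hk : 0 < k) (hc₁ : 0 < c₁) (hc₂ : 0 < c₂)
    (hN : N = -k + √(m + k ^ 2 * (n - 1)) ∨ N = -k - √(m + k ^ 2 * (n - 1)))
    (F : Type*) [TopologicalSpace F] [ChartedSpace (EuclideanSpace ℝ (Fin m)) F]
    [IsManifold (𝓡 m) ∞ F]
    (gF : BilinField (𝓡 m) F) (hgF : IsSemiRiemannianMetric gF) (hflat : gF.IsRicciFlat)
    (φ f h : EuclideanSpace ℝ (Fin n) → ℝ)
    (hφ : φ = fun x => c₂ / (N * xi α x + b) ^ (k / N))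
    (hf : f = fun x => c₁ / (N * xi α x + b) ^ (1 / N))
    (hh : h = fun x => -((m - (n - 2) * k + N) / N) * Real.log (N * xi α x + b)) :
    (N = -k + √(m + k ^ 2 * (n - 1)) → 0 < N ∧
      (solitonDomain α N b : Set (EuclideanSpace ℝ (Fin n))) = {x | -b / N < xi α x}) ∧
    (N = -k - √(m + k ^ 2 * (n - 1)) → N < 0 ∧
      (solitonDomain α N b : Set (EuclideanSpace ℝ (Fin n))) = {x | xi α x < -b / N}) ∧
    (∀ x ∈ solitonDomain α N b, 0 < φ x ∧ 0 < f x) ∧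
    ContDiffOn ℝ ∞ φ (solitonDomain α N b) ∧
    ContDiffOn ℝ ∞ f (solitonDomain α N b) ∧
    ContDiffOn ℝ ∞ h (solitonDomain α N b) ∧
    IsSteadyGradientRicciSoliton
      (warpedProduct (conformalOn (solitonDomain α N b) φ (pseudoEuclidean ε))
        (fun x => f x) gF)
      (fun p => h p.1) := by
  have hn' : (3 : ℝ) ≤ n := by exact_mod_cast hn
  have hm' : (1 : ℝ) ≤ m := by exact_mod_cast hm
  -- This makes `√(m + k² (n - 1))` larger than `k`, which gives the signs of `N₊` and `N₋`.
  have hr : k ^ 2 < m + k ^ 2 * (n - 1) := by nlinarith [sq_nonneg k]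
  have hsq : √(m + k ^ 2 * (n - 1)) ^ 2 = m + k ^ 2 * (n - 1) :=
    Real.sq_sqrt ((sq_nonneg k).trans hr.le)
  have hlt : k < √(m + k ^ 2 * (n - 1)) := Real.lt_sqrt_of_sq_lt hr
  have hN0 : N ≠ 0 := by
    rcases hN with rfl | rfl
    · linarith
    · linarith
  have hquad : N ^ 2 + 2 * k * N = m + (n - 2) * k ^ 2 := by
    rcases hN with rfl | rfl <;> linear_combination hsq
  have hξ : ContDiffOn ℝ ∞ (xi α) (solitonDomain α N b) := by
    have h := (xiL α).contDiff (n := ∞)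
    rw [show ⇑(xiL α) = xi α from funext (xiL_apply α)] at h
    exact h.contDiffOn
  have hpow (c r : ℝ) : ContDiffOn ℝ ∞ (fun x => c / (N * xi α x + b) ^ r)
      (solitonDomain α N b) :=
    contDiffOn_const.div (((contDiffOn_const.mul hξ).add contDiffOn_const).rpow_const_of_ne
      fun x hx => ne_of_gt hx) fun x hx => (Real.rpow_pos_of_pos hx _).ne'
  subst hφ hf hh
  refine ⟨fun h => ?_, fun h => ?_, fun x hx => ⟨?_, ?_⟩, hpow _ _, hpow _ _, ?_, ?_⟩
  · have hpos : 0 < N := by linarith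
    refine ⟨hpos, Set.ext fun x => ?_⟩
    change 0 < N * xi α x + b ↔ -b / N < xi α x
    rw [div_lt_iff₀ hpos]
    constructor <;> intro h <;> linarith
  · have hneg : N < 0 := by linarith
    refine ⟨hneg, Set.ext fun x => ?_⟩
    change 0 < N * xi α x + b ↔ xi α x < -b / N
    rw [lt_div_iff_of_neg hneg]
    constructor <;> intro h <;> linarith
  · exact div_pos hc₂ (Real.rpow_pos_of_pos hx _)
  · exact div_pos hc₁ (Real.rpow_pos_of_pos hx _)
  · exact contDiffOn_const.mul (((contDiffOn_const.mul hξ).add contDiffOn_const).log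
      fun x hx => ne_of_gt hx)
  · exact isSteadyGradientRicciSoliton_warpedProduct
      (fun i => by rcases hε i with h | h <;> simp [h]) α hc₁.ne' hc₂.ne' hN0 hquad hgF hflat
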